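/- Let $\mathbb T=\mathbb R/2\pi\mathbb Z$ with the probability measure $d\mu=dx/2\pi$, and let $L^2(\mathbb T)=L^2(\mathbb T,\mu;\mathbb C)$. For a bounded operator $W$ on $L^2(\mathbb T)$ define its $\mu$-norm by $$\|W\|_\mu=\inf_\chi\Big(\sum_{j=1}^J\mu(Y_j)\,\|W\pi_{Y_j}\|^2\Big)^{1/2},$$ where the infimum is over all finite partitions $\chi=\{Y_1,\dots,Y_J\}$ of $\mathbb T$ into measurable sets (up to $\mu$-null sets), $\pi_Y f=\mathbf 1_Y f$, and $\|\cdot\|$ is the operator norm. For a bounded sequence $\lambda=(\lambda_k)_{k\in\mathbb Z}$ of complex numbers let $\mathrm{Conv}_\lambda$ be the operator of convolution with the distribution $\lambda(x)=\sum_{k\in\mathbb Z}\lambda_k e^{ikx}$, that is, the bounded operator on $L^2(\mathbb T)$ that maps $\sum_k f_k e^{ikx}$ to $\sum_k\lambda_k f_k e^{ikx}$. Then $$\|\mathrm{Conv}_\lambda\|_\mu^2=\rho(\lambda),\qquad \rho(\lambda)=\limsup_{\#I\to\infty}\frac1{\#I}\sum_{k\in I}|\lambda_k|^2,$$ where $I$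 runs over the finite integer intervals $\{n,n+1,\dots,m\}\subset\mathbb Z$. In particular there are noncompact operators with $\mu$-norm $0$: if $\lambda_k=1$ for $k\in\{1^2,2^2,3^2,\dots\}$ and $\lambda_k=0$ otherwise, then $\mathrm{Conv}_\lambda$ is not compact and $\|\mathrm{Conv}_\lambda\|_\mu=0$. -/

import Mathlib

open MeasureTheory Filter
open scoped Real ENNReal

noncomputable section

namespace MuNorm

section General

variable {X : Type*} [MeasurableSpace X]

/-- The orthogonal projector `π_Y : L²(X, μ) → L²(X, μ)`, `f ↦ 1_Y · f`. -/
def proj (μ : Measure X) (Y : Set X) (hY : MeasurableSet Y) : Lp ℂ 2 μ →L[ℂ] Lp ℂ 2 μ :=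
  LinearMap.mkContinuous
    { toFun := fun f => ((Lp.memLp f).indicator hY).toLp (Y.indicator f)
      map_add' := fun f g => by
        rw [← MemLp.toLp_add, MemLp.toLp_eq_toLp_iff, ← Set.indicator_add']
        filter_upwards [Lp.coeFn_add f g] with x hx
        by_cases hxY : x ∈ Y
        · simpa [hxY] using hx
        · simp [hxY]
      map_smul' := fun c f => by
        rw [RingHom.id_apply, ← MemLp.toLp_const_smul, MemLp.toLp_eq_toLp_iff]
        filter_upwards [Lp.coeFn_smul c f] with x hx
        by_cases hxY : x ∈ Y
        · simpa [hxY] using hx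
        · simp [hxY] }
    1 (fun f => by
      rw [one_mul]
      refine Lp.norm_le_norm_of_ae_le ?_
      filter_upwards [((Lp.memLp f).indicator hY).coeFn_toLp] with x hx
      simp only [LinearMap.coe_mk, AddHom.coe_mk, hx]
      exact norm_indicator_le_norm_self _ _)

theorem proj_coeFn (μ : Measure X) (Y : Set X) (hY : MeasurableSet Y) (f : Lp ℂ 2 μ) :
    (proj μ Y hY f : X → ℂ) =ᵐ[μ] Y.indicator f :=
  ((Lp.memLp f).indicator hY).coeFn_toLp

/-- A finite measurable partition `{Y₁, …, Y_J}` of `X`, up to `μ`-null sets. -/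
structure Partition (μ : Measure X) where
  card : ℕ
  part : Fin card → Set X
  measurable : ∀ j, MeasurableSet (part j)
  cover : μ (⋃ j, part j)ᶜ = 0
  disjoint : ∀ j k, j ≠ k → μ (part j ∩ part k) = 0

/-- `M_χ(W) = ∑ⱼ μ(Yⱼ) ‖W π_{Yⱼ}‖²`. -/
def partitionSum (μ : Measure X) (W : Lp ℂ 2 μ →L[ℂ] Lp ℂ 2 μ) (χ : Partition μ) : ℝ :=
  ∑ j, μ.real (χ.part j) * ‖W ∘L proj μ (χ.part j) (χ.measurable j)‖ ^ 2

/-- The `μ`-norm `‖W‖_μ = inf_χ √(M_χ(W))`, over all finite measurable partitions `χ`. -/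
def muNorm (μ : Measure X) (W : Lp ℂ 2 μ →L[ℂ] Lp ℂ 2 μ) : ℝ :=
  ⨅ χ : Partition μ, √(partitionSum μ W χ)

/-- The trivial partition `{X}`; hence the infimum above is over a nonempty set. -/
instance (μ : Measure X) : Nonempty (Partition μ) :=
  ⟨{ card := 1
     part := fun _ => Set.univ
     measurable := fun _ => MeasurableSet.univ
     cover := by rw [Set.iUnion_const, Set.compl_univ, measure_empty]
     disjoint := fun j k hjk => absurd (Subsingleton.elim j k) hjk }⟩

end General

section Circle

instance factTwoPi : Fact (0 < 2 * π) := ⟨Real.two_pi_pos⟩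

/-- The circle `𝕋 = ℝ / 2πℤ`. -/
abbrev Torus : Type := AddCircle (2 * π)

/-- The normalized Lebesgue measure `dμ = dx / 2π` on `𝕋`. -/
abbrev haarT : Measure Torus := AddCircle.haarAddCircle

/-- The Hilbert space `L²(𝕋) = L²(𝕋, dx / 2π; ℂ)`. -/
abbrev L2T : Type := Lp ℂ 2 haarT

/-- The convolution operator `Conv_λ f = λ * f` with the distribution
`λ(x) = ∑ₖ λₖ e^{ikx}`, for a bounded sequence `(λₖ)`. In terms of Fourier series it maps
`∑ₖ fₖ e^{ikx}` to `∑ₖ λₖ fₖ e^{ikx}`; see `conv_hasSum` and `integral_kernel_mul`. -/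
def conv (lam : ℤ → ℂ) (h : BddAbove (Set.range fun k => ‖lam k‖)) : L2T →L[ℂ] L2T :=
  ((fourierBasis (T := 2 * π)).repr.symm.toContinuousLinearEquiv :
      lp (fun _ : ℤ => ℂ) 2 →L[ℂ] L2T) ∘L
    lp.mapCLM 2 (fun k => lam k • ContinuousLinearMap.id ℂ ℂ)
      (K := ⨆ k, ‖lam k‖) (Real.iSup_nonneg fun k => norm_nonneg (lam k)) (fun k => by simpa [norm_smul] using le_ciSup h k) ∘L
    ((fourierBasis (T := 2 * π)).repr.toContinuousLinearEquiv :
      L2T →L[ℂ] lp (fun _ : ℤ => ℂ) 2)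

theorem fourierCoeff_conv (lam : ℤ → ℂ) (h : BddAbove (Set.range fun k => ‖lam k‖)) (f : L2T)
    (k : ℤ) : fourierCoeff (conv lam h f) k = lam k * fourierCoeff f k := by
  rw [← fourierBasis_repr, ← fourierBasis_repr]
  simp [conv]

/-- `λ * f = ∑ₖ λₖ fₖ e^{ikx}`, with convergence in `L²(𝕋)`. -/
theorem conv_hasSum (lam : ℤ → ℂ) (h : BddAbove (Set.range fun k => ‖lam k‖)) (f : L2T) :
    HasSum (fun k => (lam k * fourierCoeff f k) • fourierLp (T := 2 * π) 2 k) (conv lam h f) := by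
  simpa only [fourierCoeff_conv] using hasSum_fourier_series_L2 (conv lam h f)

/-- The partial sums of the series above are the convolutions
`(1/2π) ∫ λ_s(x - y) f(y) dy` with the partial sums `λ_s(x) = ∑_{k ∈ s} λₖ e^{ikx}`
of the distribution `λ`. -/
theorem integral_kernel_mul (lam : ℤ → ℂ) (s : Finset ℤ) (f : L2T) (x : Torus) :
    ∫ y, (∑ k ∈ s, lam k * fourier k (x - y)) * f y ∂haarT =
      ∑ k ∈ s, lam k * fourierCoeff f k * fourier k x := by
  have hf : Integrable f haarT := (Lp.memLp f).integrable (by norm_num)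
  have key : ∀ (k : ℤ) (y : Torus), lam k * fourier k (x - y) * f y =
      lam k * fourier k x * (fourier (-k) y • f y) := by
    intro k y
    have : (fourier k (x - y) : ℂ) = fourier k x * fourier (-k) y := by
      simp only [fourier_apply, sub_eq_add_neg, AddCircle.toCircle_add, neg_smul,
        Circle.coe_mul, smul_add, smul_neg]
    rw [this, smul_eq_mul]
    ring
  simp only [Finset.sum_mul, key]
  rw [integral_finsetSum _ fun k _ => (hf.fourier_smul (-k)).const_mul _]
  refine Finset.sum_congr rfl fun k _ => ?_
  rw [integral_const_mul, fourierCoeff]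
  ring

/-- `ρ_I(λ) = (1 / #I) ∑_{k ∈ I} |λₖ|²`. -/
def intervalMean (lam : ℤ → ℂ) (I : Finset ℤ) : ℝ :=
  (∑ k ∈ I, ‖lam k‖ ^ 2) / (I.card : ℝ)

/-- `ρ(λ) = limsup_{#I → ∞} ρ_I(λ)`, where `I = {n, n + 1, …, m}` runs over the integer
intervals. -/
def rho (lam : ℤ → ℂ) : ℝ :=
  limsup (fun p : ℤ × ℤ => intervalMean lam (Finset.Icc p.1 p.2))
    (comap (fun p : ℤ × ℤ => (Finset.Icc p.1 p.2).card) atTop)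

/-- The coefficients of the distribution `d_Λ(x) = ∑_{k ∈ Λ} e^{ikx}`. -/
def indicatorSeq (S : Set ℤ) : ℤ → ℂ := S.indicator 1

theorem bddAbove_indicatorSeq (S : Set ℤ) :
    BddAbove (Set.range fun k => ‖indicatorSeq S k‖) := by
  refine ⟨1, ?_⟩
  rintro _ ⟨k, rfl⟩
  by_cases hk : k ∈ S <;> simp [indicatorSeq, hk]

/-- The set `{k² : k = 1, 2, 3, …}`. -/
def squares : Set ℤ := {m | ∃ k : ℕ, 1 ≤ k ∧ m = (k : ℤ) ^ 2}

end Circle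

end MuNorm

end

namespace MuNorm

/-! Write e_n for the character e^{inx} and W for the convolution. Multiplication by e_n is unitary
and shifts Fourier coefficients, so by Parseval ‖W(e_n g)‖² = ∑_k |λ_{k+n}|² |g_k|². Both
inequalities come from averaging this identity over n.

Upper bound: on a small enough set Y, each e_s with 0 ≤ s < L is almost constant. For g supported in
Y this makes ‖W g‖ nearly at most ‖W(e_s g)‖, and averaging over s replaces |λ_k|² by its means over
intervals of length L, which are below any b > ρ once L is large (`sq_norm_conv_le`). A partition
into such sets gives `muNorm_conv_sq_le_rho`.

Lower bound: for any Y, the functions e_n 1_Y have squared norm μ(Y) and are fixed by π_Y. Averaging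
‖W(e_n 1_Y)‖² over long intervals of n with mean near ρ gives ρ ≤ ‖Wπ_Y‖² if μ(Y) > 0
(`rho_mul_measureReal_le`), so every partition sum is at least ρ. -/

/-! ### Parseval and modulation by characters -/

theorem hasSum_sq_norm_fourierCoeff (f : L2T) :
    HasSum (fun k => ‖fourierCoeff f k‖ ^ 2) (‖f‖ ^ 2) := by
  have h := lp.hasSum_norm (p := 2) (by norm_num) (fourierBasis.repr f)
  simpa [fourierBasis_repr] using h

theorem hasSum_sq_norm_conv (lam : ℤ → ℂ) (h : BddAbove (Set.range fun k => ‖lam k‖)) (f : L2T) :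
    HasSum (fun k => ‖lam k‖ ^ 2 * ‖fourierCoeff f k‖ ^ 2) (‖conv lam h f‖ ^ 2) := by
  simpa only [fourierCoeff_conv, norm_mul, mul_pow] using
    hasSum_sq_norm_fourierCoeff (conv lam h f)

theorem norm_fourier_apply (n : ℤ) (x : Torus) : ‖fourier n x‖ = 1 := Circle.norm_coe _

theorem memLp_fourier_mul (n : ℤ) (f : L2T) : MemLp (fun x => fourier n x * f x) 2 haarT := by
  refine (Lp.memLp f).of_le ?_ (Eventually.of_forall fun x => ?_)
  · exact (fourier n).continuous.aestronglyMeasurable.mul (Lp.aestronglyMeasurable f)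
  · rw [norm_mul, norm_fourier_apply, one_mul]

/-- Multiplication by the character `e^{inx}`. -/
noncomputable def modulate (n : ℤ) (f : L2T) : L2T := (memLp_fourier_mul n f).toLp

theorem coeFn_modulate (n : ℤ) (f : L2T) :
    modulate n f =ᵐ[haarT] fun x => fourier n x * f x :=
  (memLp_fourier_mul n f).coeFn_toLp

theorem norm_modulate (n : ℤ) (f : L2T) : ‖modulate n f‖ = ‖f‖ := by
  have h : ∀ᵐ x ∂haarT, ‖modulate n f x‖ = ‖f x‖ := by
    filter_upwards [coeFn_modulate n f] with x hx
    rw [hx, norm_mul, norm_fourier_apply, one_mul]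
  exact le_antisymm (Lp.norm_le_norm_of_ae_le (h.mono fun x hx => hx.le))
    (Lp.norm_le_norm_of_ae_le (h.mono fun x hx => hx.ge))

theorem fourierCoeff_modulate (n : ℤ) (f : L2T) (k : ℤ) :
    fourierCoeff (modulate n f) k = fourierCoeff f (k - n) := by
  unfold fourierCoeff
  refine integral_congr_ae ?_
  filter_upwards [coeFn_modulate n f] with x hx
  rw [hx, smul_eq_mul, smul_eq_mul, ← mul_assoc, ← fourier_add]
  congr 3
  ring

theorem hasSum_sq_norm_conv_modulate (lam : ℤ → ℂ)
    (h : BddAbove (Set.range fun k => ‖lam k‖)) (n : ℤ) (f : L2T) :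
    HasSum (fun k => ‖lam (k + n)‖ ^ 2 * ‖fourierCoeff f k‖ ^ 2)
      (‖conv lam h (modulate n f)‖ ^ 2) := by
  have := (Equiv.addRight n).hasSum_iff.2 (hasSum_sq_norm_conv lam h (modulate n f))
  simpa [Function.comp_def, fourierCoeff_modulate] using this

/-! ### Interval means and their limsup -/

theorem intervalMean_nonneg (lam : ℤ → ℂ) (I : Finset ℤ) : 0 ≤ intervalMean lam I := by
  unfold intervalMean; positivity

theorem intervalMean_le {lam : ℤ → ℂ} {C : ℝ} (hC : ∀ k, ‖lam k‖ ≤ C) (I : Finset ℤ) :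
    intervalMean lam I ≤ C ^ 2 := by
  refine div_le_of_le_mul₀ (Nat.cast_nonneg _) (sq_nonneg C) ?_
  calc ∑ k ∈ I, ‖lam k‖ ^ 2 ≤ ∑ _k ∈ I, C ^ 2 :=
        Finset.sum_le_sum fun k _ => pow_le_pow_left₀ (norm_nonneg _) (hC k) 2
    _ = C ^ 2 * I.card := by simp [mul_comm]

/-- The filter `#I → ∞` on integer intervals. -/
noncomputable abbrev largeIntervals : Filter (ℤ × ℤ) :=
  comap (fun p : ℤ × ℤ => (Finset.Icc p.1 p.2).card) atTop

instance largeIntervals_neBot : largeIntervals.NeBot := by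
  refine NeBot.comap_of_surj inferInstance fun n => ⟨(1, n), ?_⟩
  simp

theorem eventually_largeIntervals {P : ℤ × ℤ → Prop} :
    (∀ᶠ p in largeIntervals, P p) ↔
      ∃ N : ℕ, ∀ p : ℤ × ℤ, N ≤ (Finset.Icc p.1 p.2).card → P p := by
  simp only [eventually_comap, eventually_atTop]
  exact ⟨fun ⟨N, h⟩ => ⟨N, fun p hp => h _ hp p rfl⟩,
    fun ⟨N, h⟩ => ⟨N, fun b hb p hp => h p (hp ▸ hb)⟩⟩

theorem isBoundedUnder_le_intervalMean {lam : ℤ → ℂ}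
    (h : BddAbove (Set.range fun k => ‖lam k‖)) :
    largeIntervals.IsBoundedUnder (· ≤ ·)
      fun p : ℤ × ℤ => intervalMean lam (Finset.Icc p.1 p.2) := by
  obtain ⟨C, hC⟩ := h
  exact isBoundedUnder_of ⟨C ^ 2, fun p => intervalMean_le (fun k => hC ⟨k, rfl⟩) _⟩

theorem isBoundedUnder_ge_intervalMean (lam : ℤ → ℂ) :
    largeIntervals.IsBoundedUnder (· ≥ ·)
      fun p : ℤ × ℤ => intervalMean lam (Finset.Icc p.1 p.2) :=
  isBoundedUnder_of ⟨0, fun _ => intervalMean_nonneg _ _⟩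

theorem rho_nonneg {lam : ℤ → ℂ} (h : BddAbove (Set.range fun k => ‖lam k‖)) : 0 ≤ rho lam :=
  le_limsup_of_frequently_le (Frequently.of_forall fun _ => intervalMean_nonneg _ _)
    (isBoundedUnder_le_intervalMean h)

/-- The threshold depends on the length alone, not on the position of the interval; the upper bound
needs this uniformity. -/
theorem exists_forall_intervalMean_lt {lam : ℤ → ℂ}
    (h : BddAbove (Set.range fun k => ‖lam k‖)) {b : ℝ} (hb : rho lam < b) :
    ∃ N : ℕ, ∀ p : ℤ × ℤ, N ≤ (Finset.Icc p.1 p.2).card →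
      intervalMean lam (Finset.Icc p.1 p.2) < b :=
  eventually_largeIntervals.1
    (eventually_lt_of_limsup_lt hb (isBoundedUnder_le_intervalMean h))

theorem exists_lt_intervalMean {lam : ℤ → ℂ} {a : ℝ} (ha : a < rho lam) (N : ℕ) :
    ∃ p : ℤ × ℤ, N ≤ (Finset.Icc p.1 p.2).card ∧
      a < intervalMean lam (Finset.Icc p.1 p.2) := by
  have hf := frequently_lt_of_lt_limsup
    (isBoundedUnder_ge_intervalMean lam).isCoboundedUnder_le ha
  by_contra! hcon
  exact hf (eventually_largeIntervals.2 ⟨N, fun p hp => not_lt.2 (hcon p hp)⟩)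

/-- Squares of norms averaged over the translates `k, k + 1, …, k + L - 1`. -/
theorem sum_range_eq_intervalMean (lam : ℤ → ℂ) (L : ℕ) (hL : 0 < L) (k : ℤ) :
    ∑ s ∈ Finset.range L, ‖lam (k + s)‖ ^ 2 =
      L * intervalMean lam (Finset.Icc k (k + L - 1)) := by
  have hcard : (Finset.Icc k (k + L - 1)).card = L := by simp
  have h : ∑ j ∈ Finset.Icc k (k + L - 1), ‖lam j‖ ^ 2 =
      ∑ s ∈ Finset.range L, ‖lam (k + s)‖ ^ 2 := by
    symm
    refine Finset.sum_bij (fun s _ => k + (s : ℤ)) ?_ ?_ ?_ fun _ _ => rfl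
    · intro s hs
      simp only [Finset.mem_range, Finset.mem_Icc] at *
      omega
    · intro s _ t _ hst
      simpa using hst
    · intro j hj
      simp only [Finset.mem_Icc] at hj
      refine ⟨(j - k).toNat, ?_, ?_⟩
      · simp only [Finset.mem_range]; omega
      · omega
  have : (L : ℝ) ≠ 0 := by positivity
  rw [intervalMean, hcard, h]
  field_simp


/-! ### Partitions and the μ-norm -/

theorem Partition.sum_measureReal_part {X : Type*} [MeasurableSpace X] {μ : Measure X}
    [IsProbabilityMeasure μ] (χ : Partition μ) : ∑ j, μ.real (χ.part j) = 1 := by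
  have h1 : μ (⋃ j, χ.part j) = 1 :=
    (prob_compl_eq_zero_iff (MeasurableSet.iUnion χ.measurable)).1 χ.cover
  have h2 := measure_iUnion₀ (μ := μ) (f := χ.part) (fun j k hjk => χ.disjoint j k hjk)
    fun j => (χ.measurable j).nullMeasurableSet
  rw [h1, tsum_fintype] at h2
  simp only [Measure.real]
  rw [← ENNReal.toReal_sum fun j _ => measure_ne_top _ _, ← h2, ENNReal.toReal_one]

theorem norm_proj_le {X : Type*} [MeasurableSpace X] (μ : Measure X) (Y : Set X)
    (hY : MeasurableSet Y) (f : Lp ℂ 2 μ) : ‖proj μ Y hY f‖ ≤ ‖f‖ := by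
  refine Lp.norm_le_norm_of_ae_le ?_
  filter_upwards [proj_coeFn μ Y hY f] with x hx
  rw [hx]
  exact norm_indicator_le_norm_self _ _

theorem partitionSum_nonneg {X : Type*} [MeasurableSpace X] (μ : Measure X)
    (W : Lp ℂ 2 μ →L[ℂ] Lp ℂ 2 μ) (χ : Partition μ) : 0 ≤ partitionSum μ W χ :=
  Finset.sum_nonneg fun _ _ => by positivity

theorem muNorm_sq_le {X : Type*} [MeasurableSpace X] (μ : Measure X)
    (W : Lp ℂ 2 μ →L[ℂ] Lp ℂ 2 μ) (χ : Partition μ) : muNorm μ W ^ 2 ≤ partitionSum μ W χ := by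
  have h0 : 0 ≤ muNorm μ W := Real.iInf_nonneg fun _ => Real.sqrt_nonneg _
  have h1 : muNorm μ W ≤ √(partitionSum μ W χ) :=
    ciInf_le ⟨0, by rintro _ ⟨χ, rfl⟩; exact Real.sqrt_nonneg _⟩ χ
  exact (Real.le_sqrt h0 (partitionSum_nonneg μ W χ)).1 h1

theorem le_muNorm_sq {X : Type*} [MeasurableSpace X] (μ : Measure X)
    (W : Lp ℂ 2 μ →L[ℂ] Lp ℂ 2 μ) {a : ℝ} (ha : 0 ≤ a)
    (h : ∀ χ : Partition μ, a ≤ partitionSum μ W χ) : a ≤ muNorm μ W ^ 2 := by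
  rw [← Real.sq_sqrt ha]
  exact pow_le_pow_left₀ (Real.sqrt_nonneg _)
    (le_ciInf fun χ => Real.sqrt_le_sqrt (h χ)) 2

/-! ### Upper bound: fine partitions -/

/-- A compact space has partitions subordinate to any family of open neighbourhoods. -/
theorem exists_partition_subordinate {X : Type*} [TopologicalSpace X] [CompactSpace X]
    [MeasurableSpace X] [OpensMeasurableSpace X] (μ : Measure X) (U : X → Set X)
    (hU : ∀ c, IsOpen (U c)) (hmem : ∀ c, c ∈ U c) :
    ∃ χ : Partition μ, ∀ j, ∃ c, χ.part j ⊆ U c := by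
  obtain ⟨t, ht⟩ := CompactSpace.elim_nhds_subcover U fun c => (hU c).mem_nhds (hmem c)
  let c : Fin t.card → X := fun j => t.equivFin.symm j
  let V : Fin t.card → Set X := fun j => U (c j)
  have hcover : ⋃ j, disjointed V j = Set.univ := by
    rw [iUnion_disjointed, Set.eq_univ_iff_forall]
    intro x
    have hx : x ∈ ⋃ y ∈ t, U y := by rw [ht]; trivial
    obtain ⟨y, hy, hxy⟩ := Set.mem_iUnion₂.1 hx
    refine Set.mem_iUnion.2 ⟨t.equivFin ⟨y, hy⟩, ?_⟩
    simpa [V, c] using hxy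
  refine ⟨⟨t.card, disjointed V, fun j => ?_, ?_, fun j k hjk => ?_⟩,
    fun j => ⟨c j, disjointed_le V j⟩⟩
  · exact disjointedRec (fun _ _ ht => ht.diff (hU _).measurableSet) (hU _).measurableSet
  · rw [hcover, Set.compl_univ, measure_empty]
  · rw [(disjoint_disjointed V hjk).inter_eq, measure_empty]

theorem exists_partition_fourier_close (L : ℕ) {η : ℝ} (hη : 0 < η) :
    ∃ χ : Partition haarT, ∀ j, ∃ c : Torus, ∀ x ∈ χ.part j, ∀ s ∈ Finset.range L,
      ‖fourier (s : ℤ) c - fourier (s : ℤ) x‖ ≤ η := by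
  let U : Torus → Set Torus := fun c =>
    ⋂ s ∈ Finset.range L, {x | ‖fourier (s : ℤ) c - fourier (s : ℤ) x‖ < η}
  obtain ⟨χ, hχ⟩ := exists_partition_subordinate haarT U
    (fun c => isOpen_biInter_finset fun s _ => isOpen_lt (by fun_prop) continuous_const)
    (fun c => Set.mem_iInter₂.2 fun s _ => by simpa using hη)
  refine ⟨χ, fun j => ?_⟩
  obtain ⟨c, hc⟩ := hχ j
  exact ⟨c, fun x hx s hs => (Set.mem_iInter₂.1 (hc hx) s hs).le⟩

theorem norm_smul_sub_modulate_le (s : ℤ) (c : Torus) {η : ℝ} (g : L2T)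
    (hg : ∀ᵐ x ∂haarT, g x ≠ 0 → ‖fourier s c - fourier s x‖ ≤ η) :
    ‖(fourier s c : ℂ) • g - modulate s g‖ ≤ η * ‖g‖ := by
  refine Lp.norm_le_mul_norm_of_ae_le_mul ?_
  filter_upwards [Lp.coeFn_sub ((fourier s c : ℂ) • g) (modulate s g),
    Lp.coeFn_smul (fourier s c : ℂ) g, coeFn_modulate s g, hg] with x h1 h2 h3 h4
  rw [h1, Pi.sub_apply, h2, h3, Pi.smul_apply, smul_eq_mul, ← sub_mul, norm_mul]
  by_cases hx : g x = 0
  · simp [hx]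
  · exact mul_le_mul_of_nonneg_right (h4 hx) (norm_nonneg _)

/-- After exchanging the sums over s and k, the weight of |g_k|² is L times the mean of |λ|² over an
interval of length L starting at k. -/
theorem sum_sq_norm_conv_modulate_le (lam : ℤ → ℂ) (h : BddAbove (Set.range fun k => ‖lam k‖))
    {L : ℕ} (hL : 0 < L) {b : ℝ}
    (hb : ∀ k : ℤ, intervalMean lam (Finset.Icc k (k + L - 1)) ≤ b) (g : L2T) :
    ∑ s ∈ Finset.range L, ‖conv lam h (modulate s g)‖ ^ 2 ≤ L * (b * ‖g‖ ^ 2) := by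
  have h1 := hasSum_sum (s := Finset.range L)
    fun s _ => hasSum_sq_norm_conv_modulate lam h (s : ℤ) g
  have h2 := ((hasSum_sq_norm_fourierCoeff g).mul_left b).mul_left (L : ℝ)
  refine hasSum_le (fun k => ?_) h1 h2
  rw [← Finset.sum_mul, sum_range_eq_intervalMean lam L hL, mul_assoc]
  gcongr
  exact hb k

theorem sq_norm_conv_le (lam : ℤ → ℂ) (h : BddAbove (Set.range fun k => ‖lam k‖))
    {L : ℕ} (hL : 0 < L) {b : ℝ}
    (hb : ∀ k : ℤ, intervalMean lam (Finset.Icc k (k + L - 1)) ≤ b) {η : ℝ} (hη : 0 ≤ η)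
    (c : Torus) (g : L2T)
    (hg : ∀ s ∈ Finset.range L,
      ∀ᵐ x ∂haarT, g x ≠ 0 → ‖fourier (s : ℤ) c - fourier (s : ℤ) x‖ ≤ η) :
    ‖conv lam h g‖ ^ 2 ≤ (b + ‖conv lam h‖ ^ 2 * (2 * η + η ^ 2)) * ‖g‖ ^ 2 := by
  set W := conv lam h
  -- Replacing the scalar e_s(c) by the function e_s costs at most ‖W‖η‖g‖ in norm. Squaring, with
  -- ‖W(e_s g)‖ ≤ ‖W‖‖g‖ in the cross term, yields 2η + η².
  have key : ∀ s ∈ Finset.range L, ‖W g‖ ^ 2 ≤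
      ‖W (modulate s g)‖ ^ 2 + ‖W‖ ^ 2 * (2 * η + η ^ 2) * ‖g‖ ^ 2 := by
    intro s hs
    have h1 : ‖W g‖ ≤ ‖W (modulate s g)‖ + ‖W‖ * (η * ‖g‖) := by
      calc ‖W g‖ = ‖W ((fourier (s : ℤ) c : ℂ) • g)‖ := by
            rw [map_smul, norm_smul, norm_fourier_apply, one_mul]
        _ = ‖W (modulate s g) + W ((fourier (s : ℤ) c : ℂ) • g - modulate s g)‖ := by
            rw [← map_add, add_sub_cancel]
        _ ≤ ‖W (modulate s g)‖ + ‖W‖ * (η * ‖g‖) := by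
            refine (norm_add_le _ _).trans (add_le_add_right ((W.le_opNorm _).trans ?_) _)
            exact mul_le_mul_of_nonneg_left (norm_smul_sub_modulate_le s c g (hg s hs))
              (norm_nonneg _)
    have h2 : ‖W (modulate s g)‖ ≤ ‖W‖ * ‖g‖ := by
      simpa only [norm_modulate] using W.le_opNorm (modulate s g)
    calc ‖W g‖ ^ 2 ≤ (‖W (modulate s g)‖ + ‖W‖ * (η * ‖g‖)) ^ 2 :=
          pow_le_pow_left₀ (norm_nonneg _) h1 2
      _ = ‖W (modulate s g)‖ ^ 2 + 2 * (‖W‖ * (η * ‖g‖)) * ‖W (modulate s g)‖ +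
            ‖W‖ ^ 2 * η ^ 2 * ‖g‖ ^ 2 := by ring
      _ ≤ ‖W (modulate s g)‖ ^ 2 + 2 * (‖W‖ * (η * ‖g‖)) * (‖W‖ * ‖g‖) +
            ‖W‖ ^ 2 * η ^ 2 * ‖g‖ ^ 2 := by gcongr
      _ = _ := by ring
  have hsum := Finset.sum_le_sum key
  rw [Finset.sum_add_distrib, Finset.sum_const, Finset.sum_const, Finset.card_range,
    nsmul_eq_mul, nsmul_eq_mul] at hsum
  have hmod := sum_sq_norm_conv_modulate_le lam h hL hb g
  have hL' : (0 : ℝ) < L := by exact_mod_cast hL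
  refine le_of_mul_le_mul_left ?_ hL'
  calc (L : ℝ) * ‖W g‖ ^ 2 ≤ _ := hsum
    _ ≤ L * (b * ‖g‖ ^ 2) + L * (‖W‖ ^ 2 * (2 * η + η ^ 2) * ‖g‖ ^ 2) :=
        add_le_add_left hmod _
    _ = _ := by ring

theorem muNorm_conv_sq_le_add (lam : ℤ → ℂ) (h : BddAbove (Set.range fun k => ‖lam k‖))
    {L : ℕ} (hL : 0 < L) {b : ℝ} (hb0 : 0 ≤ b)
    (hb : ∀ k : ℤ, intervalMean lam (Finset.Icc k (k + L - 1)) ≤ b) {η : ℝ} (hη : 0 < η) :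
    muNorm haarT (conv lam h) ^ 2 ≤ b + ‖conv lam h‖ ^ 2 * (2 * η + η ^ 2) := by
  obtain ⟨χ, hχ⟩ := exists_partition_fourier_close L hη
  set B := b + ‖conv lam h‖ ^ 2 * (2 * η + η ^ 2) with hB
  have hB0 : 0 ≤ B := by positivity
  refine (muNorm_sq_le haarT _ χ).trans ?_
  have key : ∀ j, ‖conv lam h ∘L proj haarT (χ.part j) (χ.measurable j)‖ ^ 2 ≤ B := by
    intro j
    obtain ⟨c, hc⟩ := hχ j
    refine (Real.le_sqrt (norm_nonneg _) hB0).1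
      (ContinuousLinearMap.opNorm_le_bound _ (Real.sqrt_nonneg _) fun f => ?_)
    refine le_trans ?_ (mul_le_mul_of_nonneg_left
      (norm_proj_le haarT (χ.part j) (χ.measurable j) f) (Real.sqrt_nonneg B))
    refine (sq_le_sq₀ (norm_nonneg _) (by positivity)).1 ?_
    rw [mul_pow, Real.sq_sqrt hB0]
    refine sq_norm_conv_le lam h hL hb hη.le c
      (proj haarT (χ.part j) (χ.measurable j) f) fun s hs => ?_
    filter_upwards [proj_coeFn haarT (χ.part j) (χ.measurable j) f] with x hx hne
    rw [hx] at hne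
    exact hc x (Set.mem_of_indicator_ne_zero hne) s hs
  calc partitionSum haarT (conv lam h) χ ≤ ∑ j, haarT.real (χ.part j) * B :=
        Finset.sum_le_sum fun j _ => mul_le_mul_of_nonneg_left (key j) measureReal_nonneg
    _ = B := by rw [← Finset.sum_mul, χ.sum_measureReal_part, one_mul]

theorem muNorm_conv_sq_le_rho (lam : ℤ → ℂ) (h : BddAbove (Set.range fun k => ‖lam k‖)) :
    muNorm haarT (conv lam h) ^ 2 ≤ rho lam := by
  refine le_of_forall_gt_imp_ge_of_dense fun b hb => ?_
  obtain ⟨N, hN⟩ := exists_forall_intervalMean_lt h hb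
  -- Length N + 1 rather than N, so that the averaging window is nonempty.
  have hmean : ∀ k : ℤ, intervalMean lam (Finset.Icc k (k + (N + 1 : ℕ) - 1)) ≤ b :=
    fun k => (hN (k, k + (N + 1 : ℕ) - 1) (by simp)).le
  have hlim : Tendsto (fun η : ℝ => b + ‖conv lam h‖ ^ 2 * (2 * η + η ^ 2))
      (nhdsWithin 0 (Set.Ioi 0)) (nhds b) := by
    refine tendsto_nhdsWithin_of_tendsto_nhds (Continuous.tendsto' (by fun_prop) _ _ (by simp))
  refine ge_of_tendsto hlim ?_
  filter_upwards [self_mem_nhdsWithin] with η hη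
  exact muNorm_conv_sq_le_add lam h N.succ_pos ((rho_nonneg h).trans hb.le) hmean hη


/-! ### Lower bound: averaging over translates -/

theorem sum_Icc_le_sum_Icc_shift {lam : ℤ → ℂ} {C : ℝ} (hC : ∀ k, ‖lam k‖ ≤ C) (m p q : ℤ) :
    ∑ n ∈ Finset.Icc p q, ‖lam n‖ ^ 2 ≤
      ∑ n ∈ Finset.Icc p q, ‖lam (m + n)‖ ^ 2 + m.natAbs * C ^ 2 := by
  have hshift : ∑ n ∈ Finset.Icc p q, ‖lam (m + n)‖ ^ 2 =
      ∑ n ∈ Finset.Icc (m + p) (m + q), ‖lam n‖ ^ 2 := by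
    rw [← Finset.image_add_left_Icc, Finset.sum_image fun _ _ _ _ => add_left_cancel]
  -- Contains every point of [p, q] missed by its translate. One of the two intervals is empty,
  -- according to the sign of m.
  let E : Finset ℤ := Finset.Icc p (p + m - 1) ∪ Finset.Icc (q + m + 1) q
  have hE : E.card ≤ m.natAbs := by
    refine (Finset.card_union_le _ _).trans ?_
    simp only [Int.card_Icc]
    omega
  have hsub : Finset.Icc p q ⊆ Finset.Icc (m + p) (m + q) ∪ E := by
    intro n hn
    simp only [E, Finset.mem_union, Finset.mem_Icc] at *
    omega
  have hsumE : ∑ n ∈ E, ‖lam n‖ ^ 2 ≤ m.natAbs * C ^ 2 := by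
    calc ∑ n ∈ E, ‖lam n‖ ^ 2 ≤ ∑ _n ∈ E, C ^ 2 :=
          Finset.sum_le_sum fun k _ => pow_le_pow_left₀ (norm_nonneg _) (hC k) 2
      _ = E.card * C ^ 2 := by simp
      _ ≤ m.natAbs * C ^ 2 := by gcongr
  rw [hshift]
  calc ∑ n ∈ Finset.Icc p q, ‖lam n‖ ^ 2
      ≤ ∑ n ∈ Finset.Icc (m + p) (m + q) ∪ E, ‖lam n‖ ^ 2 :=
        Finset.sum_le_sum_of_subset_of_nonneg hsub fun _ _ _ => by positivity
    _ ≤ ∑ n ∈ Finset.Icc (m + p) (m + q), ‖lam n‖ ^ 2 + ∑ n ∈ E, ‖lam n‖ ^ 2 := by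
        rw [← Finset.sum_union_inter]
        exact le_add_of_nonneg_right (Finset.sum_nonneg fun _ _ => by positivity)
    _ ≤ _ := add_le_add_right hsumE _

/-- Convolving `|λ|²` with a finitely supported nonnegative weight multiplies its upper mean, and
hence a lower bound for its supremum, by the total mass of the weight. -/
theorem rho_mul_sum_le {lam : ℤ → ℂ} (h : BddAbove (Set.range fun k => ‖lam k‖))
    (S : Finset ℤ) {w : ℤ → ℝ} (hw : ∀ m, 0 ≤ w m) {B : ℝ}
    (hB : ∀ n : ℤ, ∑ m ∈ S, ‖lam (m + n)‖ ^ 2 * w m ≤ B) :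
    rho lam * ∑ m ∈ S, w m ≤ B := by
  obtain ⟨C, hC⟩ := h
  replace hC : ∀ k, ‖lam k‖ ≤ C := fun k => hC ⟨k, rfl⟩
  set A := ∑ m ∈ S, w m
  have hA : 0 ≤ A := Finset.sum_nonneg fun m _ => hw m
  -- Total boundary cost of the shifts: finite because S is, and independent of [p, q], so it
  -- vanishes after division by the length.
  set D := ∑ m ∈ S, (m.natAbs * C ^ 2) * w m
  have hD : 0 ≤ D := Finset.sum_nonneg fun m _ => mul_nonneg (by positivity) (hw m)
  have hI : ∀ p q : ℤ, (∑ n ∈ Finset.Icc p q, ‖lam n‖ ^ 2) * A ≤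
      (Finset.Icc p q).card * B + D := by
    intro p q
    calc (∑ n ∈ Finset.Icc p q, ‖lam n‖ ^ 2) * A
        ≤ ∑ m ∈ S, (∑ n ∈ Finset.Icc p q, ‖lam (m + n)‖ ^ 2 + m.natAbs * C ^ 2) * w m := by
          rw [Finset.mul_sum]
          exact Finset.sum_le_sum fun m _ =>
            mul_le_mul_of_nonneg_right (sum_Icc_le_sum_Icc_shift hC m p q) (hw m)
      _ = ∑ n ∈ Finset.Icc p q, ∑ m ∈ S, ‖lam (m + n)‖ ^ 2 * w m + D := by
          simp only [add_mul, Finset.sum_add_distrib, Finset.sum_mul]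
          rw [Finset.sum_comm]
      _ ≤ ∑ _n ∈ Finset.Icc p q, B + D := by gcongr with n; exact hB n
      _ = _ := by simp
  have hr : ∀ r < rho lam, r * A ≤ B := by
    intro r hr
    have hlim : Tendsto (fun N : ℕ => B + D / (N : ℝ)) atTop (nhds B) := by
      simpa using (tendsto_const_nhds (x := B)).add
        (tendsto_const_div_atTop_nhds_zero_nat D)
    refine ge_of_tendsto hlim ?_
    filter_upwards [eventually_gt_atTop 0] with N hN
    obtain ⟨⟨p, q⟩, hcard, hmean⟩ := exists_lt_intervalMean hr N
    have hN' : (0 : ℝ) < N := by exact_mod_cast hN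
    have hcard' : (N : ℝ) ≤ (Finset.Icc p q).card := by exact_mod_cast hcard
    have hpos : (0 : ℝ) < (Finset.Icc p q).card := hN'.trans_le hcard'
    calc r * A ≤ intervalMean lam (Finset.Icc p q) * A := by gcongr
      _ = ((∑ n ∈ Finset.Icc p q, ‖lam n‖ ^ 2) * A) / (Finset.Icc p q).card := by
          rw [intervalMean]; ring
      _ ≤ ((Finset.Icc p q).card * B + D) / (Finset.Icc p q).card := by
          gcongr; exact hI p q
      _ = B + D / (Finset.Icc p q).card := by field_simp
      _ ≤ B + D / N := by gcongr
  have hlim : Tendsto (fun r : ℝ => r * A) (nhdsWithin (rho lam) (Set.Iio (rho lam)))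
      (nhds (rho lam * A)) :=
    tendsto_nhdsWithin_of_tendsto_nhds (Continuous.tendsto (by fun_prop) _)
  refine le_of_tendsto hlim ?_
  filter_upwards [self_mem_nhdsWithin] with r hr'
  exact hr r hr'

theorem norm_sq_indicatorConstLp {Y : Set Torus} (hY : MeasurableSet Y) :
    ‖indicatorConstLp 2 hY (measure_ne_top haarT Y) (1 : ℂ)‖ ^ 2 = haarT.real Y := by
  rw [norm_indicatorConstLp (by norm_num) (by norm_num), norm_one, one_mul, ENNReal.toReal_ofNat,
    ← Real.sqrt_eq_rpow, Real.sq_sqrt measureReal_nonneg]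

theorem proj_modulate_indicatorConstLp {Y : Set Torus} (hY : MeasurableSet Y) (n : ℤ) :
    proj haarT Y hY (modulate n (indicatorConstLp 2 hY (measure_ne_top haarT Y) (1 : ℂ))) =
      modulate n (indicatorConstLp 2 hY (measure_ne_top haarT Y) (1 : ℂ)) := by
  refine Lp.ext ?_
  filter_upwards [proj_coeFn haarT Y hY
      (modulate n (indicatorConstLp 2 hY (measure_ne_top haarT Y) (1 : ℂ))),
    coeFn_modulate n (indicatorConstLp 2 hY (measure_ne_top haarT Y) (1 : ℂ)),
    indicatorConstLp_coeFn (p := 2) (hs := hY) (hμs := measure_ne_top haarT Y) (c := (1 : ℂ))]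
    with x h1 h2 h3
  rw [h1]
  by_cases hx : x ∈ Y
  · rw [Set.indicator_of_mem hx]
  · rw [Set.indicator_of_notMem hx, h2, h3, Set.indicator_of_notMem hx, mul_zero]

theorem rho_mul_measureReal_le (lam : ℤ → ℂ) (h : BddAbove (Set.range fun k => ‖lam k‖))
    {Y : Set Torus} (hY : MeasurableSet Y) :
    rho lam * haarT.real Y ≤ haarT.real Y * ‖conv lam h ∘L proj haarT Y hY‖ ^ 2 := by
  set g : L2T := indicatorConstLp 2 hY (measure_ne_top haarT Y) (1 : ℂ) with hg
  have hgn : ‖g‖ ^ 2 = haarT.real Y := norm_sq_indicatorConstLp hY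
  have hB : ∀ n : ℤ, ‖conv lam h (modulate n g)‖ ^ 2 ≤
      haarT.real Y * ‖conv lam h ∘L proj haarT Y hY‖ ^ 2 := by
    intro n
    have h1 := (conv lam h ∘L proj haarT Y hY).le_opNorm (modulate n g)
    rw [ContinuousLinearMap.comp_apply, hg, proj_modulate_indicatorConstLp, ← hg,
      norm_modulate] at h1
    calc ‖conv lam h (modulate n g)‖ ^ 2 ≤ _ := pow_le_pow_left₀ (norm_nonneg _) h1 2
      _ = _ := by rw [mul_pow, hgn, mul_comm]
  have hsum := (hasSum_sq_norm_fourierCoeff g).mul_left (rho lam)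
  rw [hgn] at hsum
  -- Truncating to finitely many frequencies keeps the boundary cost of the shifts finite; the
  -- weights are |g_m|².
  refine hasSum_le_of_sum_le hsum fun S => ?_
  rw [← Finset.mul_sum]
  refine rho_mul_sum_le h S (fun m => by positivity) fun n => ?_
  exact (sum_le_hasSum S (fun m _ => by positivity)
    (hasSum_sq_norm_conv_modulate lam h n g)).trans (hB n)

theorem muNorm_conv_sq (lam : ℤ → ℂ) (h : BddAbove (Set.range fun k => ‖lam k‖)) :
    muNorm haarT (conv lam h) ^ 2 = rho lam := by
  refine le_antisymm (muNorm_conv_sq_le_rho lam h)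
    (le_muNorm_sq haarT _ (rho_nonneg h) fun χ => ?_)
  calc rho lam = ∑ j, rho lam * haarT.real (χ.part j) := by
        rw [← Finset.mul_sum, χ.sum_measureReal_part, mul_one]
    _ ≤ partitionSum haarT (conv lam h) χ :=
        Finset.sum_le_sum fun j _ => rho_mul_measureReal_le lam h (χ.measurable j)


/-! ### The noncompact example -/

theorem conv_fourierLp (lam : ℤ → ℂ) (h : BddAbove (Set.range fun k => ‖lam k‖)) (n : ℤ) :
    conv lam h (fourierLp 2 n) = lam n • fourierLp 2 n := by
  have hc : ∀ k, fourierCoeff (fourierLp (T := 2 * π) 2 n) k = if k = n then 1 else 0 := by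
    intro k
    rw [← fourierBasis_repr, ← coe_fourierBasis, HilbertBasis.repr_self, lp.single_apply]
    by_cases hk : k = n
    · subst hk; simp
    · simp [hk]
  refine fourierBasis.repr.injective (lp.ext (funext fun k => ?_))
  rw [map_smul, lp.coeFn_smul, Pi.smul_apply, fourierBasis_repr, fourierBasis_repr,
    fourierCoeff_conv, hc, smul_eq_mul]
  by_cases hk : k = n
  · rw [hk]
  · simp [hk]

/-- A compact set contains no orthonormal sequence. -/
theorem not_forall_mem_isCompact_of_orthonormal {E : Type*} [NormedAddCommGroup E]
    [InnerProductSpace ℂ E] {v : ℕ → E} (hv : Orthonormal ℂ v) {K : Set E} (hK : IsCompact K) :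
    ¬ ∀ n, v n ∈ K := by
  intro hmem
  obtain ⟨a, -, φ, hφ, hlim⟩ := hK.tendsto_subseq hmem
  obtain ⟨N, hN⟩ := Metric.cauchySeq_iff'.1 hlim.cauchySeq 1 one_pos
  have h1 := hN (N + 1) N.le_succ
  have hne : φ (N + 1) ≠ φ N := (hφ N.lt_succ_self).ne'
  -- Distinct orthonormal vectors are √2 apart, so no subsequence is Cauchy.
  have h2 : ‖v (φ (N + 1)) - v (φ N)‖ ^ 2 = 2 := by
    rw [@norm_sub_sq ℂ, hv.2 hne, hv.1, hv.1]
    norm_num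
  rw [Function.comp_apply, Function.comp_apply, dist_eq_norm] at h1
  nlinarith [norm_nonneg (v (φ (N + 1)) - v (φ N))]

/-- The operator fixes e_n for n ∈ S, so the image of the unit ball contains an infinite orthonormal
family. -/
theorem not_isCompactOperator_conv_indicatorSeq {S : Set ℤ} (hS : S.Infinite) :
    ¬ IsCompactOperator (conv (indicatorSeq S) (bddAbove_indicatorSeq S)) := by
  intro hcomp
  obtain ⟨K, hK, hsub⟩ := IsCompactOperator.image_closedBall_subset_compact
    (f := (conv (indicatorSeq S) (bddAbove_indicatorSeq S) : L2T →ₗ[ℂ] L2T)) hcomp 1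
  let e : ℕ ↪ S := hS.natEmbedding
  have horth : Orthonormal ℂ fun n => fourierLp (T := 2 * π) 2 (e n : ℤ) :=
    orthonormal_fourier.comp (fun n => (e n : ℤ)) (Subtype.val_injective.comp e.injective)
  refine not_forall_mem_isCompact_of_orthonormal horth hK fun n =>
    hsub ⟨fourierLp 2 (e n : ℤ), ?_, ?_⟩
  · simpa using (horth.1 n).le
  · have hone : indicatorSeq S (e n) = 1 := by simp [indicatorSeq]
    simpa [hone] using conv_fourierLp (indicatorSeq S) (bddAbove_indicatorSeq S) (e n)

theorem infinite_squares : squares.Infinite := by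
  refine Set.infinite_of_injective_forall_mem (f := fun k : ℕ => ((k : ℤ) + 1) ^ 2) ?_ ?_
  · intro a b hab
    have := (sq_eq_sq₀ (by positivity) (by positivity)).1 hab
    omega
  · intro k
    exact ⟨k + 1, by omega, by push_cast; rfl⟩

/-- If a is the least natural number with a² ≥ p, then any square (a + d)² ≤ q has d² ≤ (a + d)² -
a² ≤ q - p, leaving at most ⌊√#I⌋ + 1 values of d. -/
theorem intervalMean_indicatorSeq_squares_le (p q : ℤ) :
    intervalMean (indicatorSeq squares) (Finset.Icc p q) ≤
      (√((Finset.Icc p q).card) + 1) / (Finset.Icc p q).card := by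
  classical
  set I := Finset.Icc p q with hI
  have hsum : ∑ k ∈ I, ‖indicatorSeq squares k‖ ^ 2 = (I.filter (· ∈ squares)).card := by
    rw [Finset.card_filter, Nat.cast_sum]
    refine Finset.sum_congr rfl fun k _ => ?_
    by_cases hk : k ∈ squares <;> simp [indicatorSeq, hk]
  have hcard : (I.filter (· ∈ squares)).card ≤ I.card.sqrt + 1 := by
    by_cases hex : ∃ k : ℕ, p ≤ (k : ℤ) ^ 2
    · set a := Nat.find hex with ha
      have hap : p ≤ (a : ℤ) ^ 2 := Nat.find_spec hex
      have hsub : I.filter (· ∈ squares) ⊆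
          (Finset.Icc a (a + I.card.sqrt)).image fun k : ℕ => (k : ℤ) ^ 2 := by
        intro m hm
        obtain ⟨hmI, k, -, rfl⟩ := Finset.mem_filter.1 hm
        rw [hI, Finset.mem_Icc] at hmI
        have hak : a ≤ k := Nat.find_min' hex hmI.1
        refine Finset.mem_image.2 ⟨k, Finset.mem_Icc.2 ⟨hak, ?_⟩, rfl⟩
        obtain ⟨d, rfl⟩ := Nat.exists_eq_add_of_le hak
        have hd : d ≤ I.card.sqrt := by
          rw [Nat.le_sqrt, hI, Int.card_Icc]
          have : ((d * d : ℕ) : ℤ) ≤ q + 1 - p := by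
            push_cast at hmI ⊢
            nlinarith [mul_nonneg (Int.natCast_nonneg a) (Int.natCast_nonneg d)]
          omega
        omega
      refine (Finset.card_le_card hsub).trans (Finset.card_image_le.trans ?_)
      simp only [Nat.card_Icc]
      omega
    · have : I.filter (· ∈ squares) = ∅ := by
        refine Finset.filter_eq_empty_iff.2 fun m hm => ?_
        rintro ⟨k, -, rfl⟩
        exact hex ⟨k, (Finset.mem_Icc.1 hm).1⟩
      simp [this]
  rw [intervalMean, hsum]
  gcongr
  calc ((I.filter (· ∈ squares)).card : ℝ) ≤ (I.card.sqrt + 1 : ℕ) := by exact_mod_cast hcard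
    _ ≤ √(I.card) + 1 := by
      push_cast
      gcongr
      exact Real.nat_sqrt_le_real_sqrt

theorem rho_indicatorSeq_squares : rho (indicatorSeq squares) = 0 := by
  have hlim : Tendsto (fun n : ℕ => (√(n : ℝ) + 1) / (n : ℝ)) atTop (nhds 0) := by
    have h1 : Tendsto (fun n : ℕ => (√(n : ℝ))⁻¹ + 1 / (n : ℝ)) atTop (nhds 0) := by
      simpa using ((Real.tendsto_sqrt_atTop.comp
        tendsto_natCast_atTop_atTop).inv_tendsto_atTop).add
        (tendsto_const_div_atTop_nhds_zero_nat (1 : ℝ))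
    refine h1.congr fun n => ?_
    rw [add_div, Real.sqrt_div_self', one_div, one_div]
  refine Tendsto.limsup_eq (tendsto_of_tendsto_of_tendsto_of_le_of_le tendsto_const_nhds
    (hlim.comp tendsto_comap) (fun _ => intervalMean_nonneg _ _) fun p => ?_)
  exact intervalMean_indicatorSeq_squares_le p.1 p.2

end MuNorm

theorem mainTheorem2 :
    (∀ (lam : ℤ → ℂ) (h : BddAbove (Set.range fun k => ‖lam k‖)),
      MuNorm.muNorm MuNorm.haarT (MuNorm.conv lam h) ^ 2 = MuNorm.rho lam) ∧
    ¬ IsCompactOperator (MuNorm.conv (MuNorm.indicatorSeq MuNorm.squares)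
        (MuNorm.bddAbove_indicatorSeq MuNorm.squares)) ∧
    MuNorm.muNorm MuNorm.haarT (MuNorm.conv (MuNorm.indicatorSeq MuNorm.squares)
        (MuNorm.bddAbove_indicatorSeq MuNorm.squares)) = 0 := by
  refine ⟨MuNorm.muNorm_conv_sq,
    MuNorm.not_isCompactOperator_conv_indicatorSeq MuNorm.infinite_squares, ?_⟩
  rw [← sq_eq_zero_iff, MuNorm.muNorm_conv_sq, MuNorm.rho_indicatorSeq_squares]
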